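/- Let $\mathcal D=\{d\in\mathbb R^2: d_1\ge 0,\ d_2\ge 0,\ d_1d_2\ge 1\}$. For $x\in[0,1]^2$, $y\in\mathbb R_+^2$ and $d\in\mathcal D$ put $$f(x,y,\lambda;d)=\frac{(d_1d_2-1)(d_1x_2y_1^2+d_2x_1y_2^2)+2\lambda d_1d_2y_1y_2+\lambda(d_1y_1^2+d_2y_2^2)}{(d_1d_2-1)x_1x_2-\lambda^2+\lambda(x_1+x_2)}$$ and $$f_+^*(x_1,x_2,y_1,y_2;d_1,d_2)=\begin{cases} \frac{d_1y_1^2}{x_1}+\frac{d_2y_2^2}{x_2}&\text{if }x_1+x_2\le1,\\ \frac{d_2y_2^2}{x_2}+\frac{d_1y_1^2}{1-x_2}&\text{else, if }y_2>0\text{ and }0\le x_1+x_2-1\le (x_1y_2-d_1x_2y_1)/y_2,\\ \frac{d_1y_1^2}{x_1}+\frac{d_2y_2^2}{1-x_1}&\text{else, if }y_1>0\text{ and }0\le x_1+x_2-1\le (x_2y_1-d_2x_1y_2)/y_1,\\ f(x,y,x_1+x_2-1;d)&\text{otherwise,} \end{cases}$$ where in the first three pieces $a/0=\infty$ for $a>0$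 and $0/0=0$; thus $f_+^*$ takes values in $[0,\infty]$. **Lemma.** Let $x_1,x_2\in[0,1]$, $y_1,y_2\ge 0$ and $Y_{11},Y_{12},Y_{22}\in\mathbb R$. Then $$\sup_{d\in\mathcal D}\left\{f_+^*(x_1,x_2,y_1,y_2;d_1,d_2)-d_1Y_{11}-d_2Y_{22}-2Y_{12}\right\}\le 0$$ if and only if there exists a symmetric positive semidefinite matrix $W\in\mathbb R^{3\times 3}$ such that \begin{align*} &W_{12}\le Y_{12},\\ &(Y_{11}-W_{11})(x_1-W_{33})\ge (y_1-W_{31})^2,\quad W_{11}\le Y_{11},\quad W_{33}\le x_1,\\ &(Y_{22}-W_{22})(x_2-W_{33})\ge (y_2-W_{32})^2,\quad W_{22}\le Y_{22},\quad W_{33}\le x_2,\\ &W_{31}\ge 0,\quad W_{32}\ge 0,\\ &W_{33}\ge x_1+x_2-1. \end{align*} -/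

import Mathlib

noncomputable section

/-- The coefficient set `𝒟 = {d ∈ ℝ² : d₁ ≥ 0, d₂ ≥ 0, d₁ d₂ ≥ 1}`. -/
def coeffSet : Set (ℝ × ℝ) :=
  {d | 0 ≤ d.1 ∧ 0 ≤ d.2 ∧ 1 ≤ d.1 * d.2}

/-- The quotient `a / b` (used for `a ≥ 0`, `b ≥ 0`) with the convention
`a / 0 = ∞` if `a ≠ 0` and `0 / 0 = 0`. -/
def quot₀ (a b : ℝ) : EReal :=
  if b = 0 then (if a = 0 then 0 else ⊤) else ((a / b : ℝ) : EReal)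

/-- The rational function `f(x, y, l; d)`.  It is only used where its denominator is positive. -/
def fPiece (x₁ x₂ y₁ y₂ l d₁ d₂ : ℝ) : ℝ :=
  ((d₁ * d₂ - 1) * (d₁ * x₂ * y₁ ^ 2 + d₂ * x₁ * y₂ ^ 2) + 2 * l * d₁ * d₂ * y₁ * y₂
      + l * (d₁ * y₁ ^ 2 + d₂ * y₂ ^ 2)) /
    ((d₁ * d₂ - 1) * x₁ * x₂ - l ^ 2 + l * (x₁ + x₂))

open Classical in
/-- The four-piece function `f₊*(x₁, x₂, y₁, y₂; d₁, d₂)`, with values in `[0, ∞]` on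
`x ∈ [0,1]²`, `y ≥ 0`, `d ∈ 𝒟`.  The guards `0 < y₂` and `0 < y₁` make explicit that the second
(third) piece, whose condition divides by `y₂` (by `y₁`), needs that number to be nonzero. -/
def fPlusStar (x₁ x₂ y₁ y₂ d₁ d₂ : ℝ) : EReal :=
  if x₁ + x₂ ≤ 1 then
    quot₀ (d₁ * y₁ ^ 2) x₁ + quot₀ (d₂ * y₂ ^ 2) x₂
  else if 0 < y₂ ∧ 0 ≤ x₁ + x₂ - 1 ∧ x₁ + x₂ - 1 ≤ (x₁ * y₂ - d₁ * x₂ * y₁) / y₂ then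
    quot₀ (d₂ * y₂ ^ 2) x₂ + quot₀ (d₁ * y₁ ^ 2) (1 - x₂)
  else if 0 < y₁ ∧ 0 ≤ x₁ + x₂ - 1 ∧ x₁ + x₂ - 1 ≤ (x₂ * y₁ - d₂ * x₁ * y₂) / y₁ then
    quot₀ (d₁ * y₁ ^ 2) x₁ + quot₀ (d₂ * y₂ ^ 2) (1 - x₁)
  else
    ((fPiece x₁ x₂ y₁ y₂ (x₁ + x₂ - 1) d₁ d₂ : ℝ) : EReal)

end

/-! For fixed `d`, the envelope value is the minimum of `d₁ * Y₁₁ + d₂ * Y₂₂ + 2 * Y₁₂` over the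
triples `Y` admitting a lift `W`, so the lemma is conic duality. A `Certificate` stores a primal and
a dual solution: the rank-one `W = l (p, 1)(p, 1)ᵀ` attains `v`, and `p`, `s` give multipliers
proving `v` a lower bound. The optimal `l` is `max 0 (x₁ + x₂ - 1)`.

A lift then bounds every `d` by weak duality. Conversely, the liftable triples form a closed convex
set. A triple outside it is strictly separated by a functional `(e₁, 2e, e₂)`, whose boundedness
below forces `0 ≤ e` and `e ^ 2 ≤ e₁ * e₂`. After a perturbation making `e` positive, division by it
gives some `d` in `coeffSet`, where the attaining lift contradicts the separation. -/

/-- The feasibility conditions on `W` in the semidefinite representation, for given `Y`. -/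
def FeasibleLift (x₁ x₂ y₁ y₂ Y₁₁ Y₁₂ Y₂₂ : ℝ) (W : Matrix (Fin 3) (Fin 3) ℝ) : Prop :=
  W.PosSemidef ∧
    W 0 1 ≤ Y₁₂ ∧
    ((y₁ - W 2 0) ^ 2 ≤ (Y₁₁ - W 0 0) * (x₁ - W 2 2) ∧ W 0 0 ≤ Y₁₁ ∧ W 2 2 ≤ x₁) ∧
    ((y₂ - W 2 1) ^ 2 ≤ (Y₂₂ - W 1 1) * (x₂ - W 2 2) ∧ W 1 1 ≤ Y₂₂ ∧ W 2 2 ≤ x₂) ∧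
    (0 ≤ W 2 0 ∧ 0 ≤ W 2 1) ∧
    x₁ + x₂ - 1 ≤ W 2 2

/-- Optimality certificate for the convex envelope at `(x, y)` with coefficients `d`:
`l` is the weight of the piece where both variables are active, `p` the slope there and
`s` the slopes on the pieces where a single variable is active. -/
structure Certificate (x₁ x₂ y₁ y₂ d₁ d₂ v : ℝ) (l p₁ p₂ s₁ s₂ : ℝ) : Prop where
  nonneg : 0 ≤ l
  le_of : ∀ m, 0 ≤ m → x₁ + x₂ - 1 ≤ m → l ≤ m
  ge : x₁ + x₂ - 1 ≤ l
  le₁ : l ≤ x₁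
  le₂ : l ≤ x₂
  slope₁ : 0 ≤ l * p₁
  slope₂ : 0 ≤ l * p₂
  split₁ : y₁ = l * p₁ + s₁ * (x₁ - l)
  split₂ : y₂ = l * p₂ + s₂ * (x₂ - l)
  grad₁ : d₁ * s₁ ≤ d₁ * p₁ + p₂
  grad₂ : d₂ * s₂ ≤ p₁ + d₂ * p₂
  weight : d₁ * p₁ ^ 2 + 2 * p₁ * p₂ + d₂ * p₂ ^ 2 ≤ d₁ * s₁ ^ 2 + d₂ * s₂ ^ 2
  dual : v = d₁ * (2 * s₁ * y₁ - s₁ ^ 2 * x₁) + d₂ * (2 * s₂ * y₂ - s₂ ^ 2 * x₂)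
    + l * (d₁ * s₁ ^ 2 + d₂ * s₂ ^ 2 - (d₁ * p₁ ^ 2 + 2 * p₁ * p₂ + d₂ * p₂ ^ 2))
  primal : v = d₁ * (l * p₁ ^ 2 + s₁ ^ 2 * (x₁ - l)) + d₂ * (l * p₂ ^ 2 + s₂ ^ 2 * (x₂ - l))
    + 2 * (l * p₁ * p₂)

/-! ### Certificates for the four pieces -/

theorem quot₀_eq_coe {a b : ℝ} (h : b = 0 → a = 0) : quot₀ a b = ((a / b : ℝ) : EReal) := by
  unfold quot₀
  by_cases hb : b = 0
  · simp [hb, h hb]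
  · simp [hb]

theorem coeffSet_pos {d : ℝ × ℝ} (hd : d ∈ coeffSet) : 0 < d.1 ∧ 0 < d.2 := by
  obtain ⟨h1, h2, h⟩ := hd
  constructor
  · rcases h1.lt_or_eq with h' | h'
    · exact h'
    · rw [← h', zero_mul] at h; linarith
  · rcases h2.lt_or_eq with h' | h'
    · exact h'
    · rw [← h', mul_zero] at h; linarith

/-- Slopes `s ≥ 0` on the single-variable pieces are dominated by a slope `p` on the joint piece. -/
theorem exists_joint_slope {d₁ d₂ s₁ s₂ : ℝ} (hd₁ : 0 < d₁) (hd₂ : 0 < d₂)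
    (hs₁ : 0 ≤ s₁) (hs₂ : 0 ≤ s₂) :
    ∃ p₁ p₂ : ℝ, d₁ * s₁ ≤ d₁ * p₁ + p₂ ∧ d₂ * s₂ ≤ p₁ + d₂ * p₂ ∧
      d₁ * p₁ ^ 2 + 2 * p₁ * p₂ + d₂ * p₂ ^ 2 ≤ d₁ * s₁ ^ 2 + d₂ * s₂ ^ 2 := by
  by_cases h1 : d₂ * s₂ ≤ s₁
  · refine ⟨s₁, 0, by linarith, by linarith, ?_⟩
    have : 0 ≤ d₂ * s₂ ^ 2 := by positivity
    linarith
  by_cases h2 : d₁ * s₁ ≤ s₂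
  · refine ⟨0, s₂, by linarith, by linarith, ?_⟩
    have : 0 ≤ d₁ * s₁ ^ 2 := by positivity
    linarith
  push Not at h1 h2
  have hs₂' : 0 < s₂ := by
    by_contra h
    have : s₂ = 0 := le_antisymm (not_lt.1 h) hs₂
    simp [this] at h1; linarith
  have hs₁' : 0 < s₁ := by
    by_contra h
    have : s₁ = 0 := le_antisymm (not_lt.1 h) hs₁
    simp [this] at h2; linarith
  -- Multiplying `h1` and `h2` gives `s₁ * s₂ < d₁ * d₂ * s₁ * s₂`, so both gradient conditions can
  -- be solved as equalities by Cramer's rule.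
  have hD : 0 < d₁ * d₂ - 1 := by
    have h := mul_lt_mul'' h1 h2 hs₁ hs₂
    by_contra h'
    have : 0 < s₁ * s₂ := by positivity
    nlinarith
  have e1 : d₁ * ((d₁ * d₂ * s₁ - d₂ * s₂) / (d₁ * d₂ - 1))
      + (d₁ * d₂ * s₂ - d₁ * s₁) / (d₁ * d₂ - 1) = d₁ * s₁ := by
    field_simp; ring
  have e2 : (d₁ * d₂ * s₁ - d₂ * s₂) / (d₁ * d₂ - 1)
      + d₂ * ((d₁ * d₂ * s₂ - d₁ * s₁) / (d₁ * d₂ - 1)) = d₂ * s₂ := by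
    field_simp; ring
  refine ⟨_, _, e1.ge, e2.ge, ?_⟩
  set p₁ := (d₁ * d₂ * s₁ - d₂ * s₂) / (d₁ * d₂ - 1) with hp₁
  set p₂ := (d₁ * d₂ * s₂ - d₁ * s₁) / (d₁ * d₂ - 1) with hp₂
  have e3 : d₁ * p₁ ^ 2 + 2 * p₁ * p₂ + d₂ * p₂ ^ 2 = d₁ * s₁ * p₁ + d₂ * s₂ * p₂ := by
    linear_combination p₁ * e1 + p₂ * e2
  have e4 : d₁ * s₁ ^ 2 + d₂ * s₂ ^ 2 - (d₁ * s₁ * p₁ + d₂ * s₂ * p₂)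
      = (s₁ * (d₂ * s₂ - s₁) * d₁ + s₂ * (d₁ * s₁ - s₂) * d₂) / (d₁ * d₂ - 1) := by
    rw [hp₁, hp₂]; field_simp; ring
  have : 0 ≤ (s₁ * (d₂ * s₂ - s₁) * d₁ + s₂ * (d₁ * s₁ - s₂) * d₂) / (d₁ * d₂ - 1) := by
    have := sub_pos.2 h1
    have := sub_pos.2 h2
    positivity
  linarith

/-- Where the envelope is finite, its value is certified. -/
theorem exists_certificate {x₁ x₂ y₁ y₂ d₁ d₂ : ℝ}
    (hx₁ : 0 ≤ x₁ ∧ x₁ ≤ 1) (hx₂ : 0 ≤ x₂ ∧ x₂ ≤ 1) (hy₁ : 0 ≤ y₁) (hy₂ : 0 ≤ y₂)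
    (h₁ : x₁ = 0 → y₁ = 0) (h₂ : x₂ = 0 → y₂ = 0)
    (hd₁ : 0 < d₁) (hd₂ : 0 < d₂) (hd : 1 ≤ d₁ * d₂) :
    ∃ v l p₁ p₂ s₁ s₂ : ℝ, fPlusStar x₁ x₂ y₁ y₂ d₁ d₂ = (v : EReal) ∧
      Certificate x₁ x₂ y₁ y₂ d₁ d₂ v l p₁ p₂ s₁ s₂ := by
  obtain ⟨hx₁0, hx₁1⟩ := hx₁
  obtain ⟨hx₂0, hx₂1⟩ := hx₂
  unfold fPlusStar
  split_ifs with c1 c2 c3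
  · obtain ⟨p₁, p₂, g1, g2, g3⟩ := exists_joint_slope hd₁ hd₂ (div_nonneg hy₁ hx₁0)
      (div_nonneg hy₂ hx₂0)
    have e1 : y₁ / x₁ * x₁ = y₁ := div_mul_cancel_of_imp h₁
    have e2 : y₂ / x₂ * x₂ = y₂ := div_mul_cancel_of_imp h₂
    have v1 : d₁ * y₁ ^ 2 / x₁ = d₁ * (y₁ / x₁) ^ 2 * x₁ := by
      conv_rhs => rw [pow_two, mul_assoc, mul_assoc, e1]
      ring
    have v2 : d₂ * y₂ ^ 2 / x₂ = d₂ * (y₂ / x₂) ^ 2 * x₂ := by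
      conv_rhs => rw [pow_two, mul_assoc, mul_assoc, e2]
      ring
    -- With `l = 0` the joint piece has no mass, so `p` only has to satisfy the dual inequalities.
    refine ⟨d₁ * y₁ ^ 2 / x₁ + d₂ * y₂ ^ 2 / x₂, 0, p₁, p₂, y₁ / x₁, y₂ / x₂, ?_, ?_⟩
    · rw [quot₀_eq_coe (fun h => by simp [h₁ h]), quot₀_eq_coe (fun h => by simp [h₂ h]),
        EReal.coe_add]
    · refine ⟨le_rfl, fun m hm _ => hm, by linarith, hx₁0, hx₂0, by simp, by simp, ?_, ?_, g1, g2,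
        g3, ?_, ?_⟩
      · linarith
      · linarith
      · rw [v1, v2]
        linear_combination 2 * d₁ * (y₁ / x₁) * e1 + 2 * d₂ * (y₂ / x₂) * e2
      · rw [v1, v2]; ring
  · obtain ⟨hy, -, hc⟩ := c2
    have hx : 0 < x₂ := by linarith
    have hc' : d₁ * x₂ * y₁ ≤ (1 - x₂) * y₂ := by
      rw [le_div_iff₀ hy] at hc; linarith
    have h0 : 1 - x₂ = 0 → y₁ = 0 := by
      intro h
      rw [h, zero_mul] at hc'
      have : 0 < d₁ * x₂ := by positivity
      nlinarith
    have e1 : y₁ / (1 - x₂) * (1 - x₂) = y₁ := div_mul_cancel_of_imp h0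
    have e2 : y₂ / x₂ * x₂ = y₂ := div_mul_cancel_of_imp h₂
    have v1 : d₁ * y₁ ^ 2 / (1 - x₂) = d₁ * (y₁ / (1 - x₂)) ^ 2 * (1 - x₂) := by
      conv_rhs => rw [pow_two, mul_assoc, mul_assoc, e1]
      ring
    have v2 : d₂ * y₂ ^ 2 / x₂ = d₂ * (y₂ / x₂) ^ 2 * x₂ := by
      conv_rhs => rw [pow_two, mul_assoc, mul_assoc, e2]
      ring
    have hs1 : 0 ≤ y₁ / (1 - x₂) := div_nonneg hy₁ (by linarith)
    have hs2 : 0 ≤ y₂ / x₂ := div_nonneg hy₂ (by linarith)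
    -- The condition selecting this piece is `grad₁` for the joint slope `(0, y₂ / x₂)`.
    have hg : d₁ * (y₁ / (1 - x₂)) ≤ y₂ / x₂ := by
      rcases (sub_nonneg.2 hx₂1).eq_or_lt with h | h
      · rw [← h, div_zero, mul_zero]; exact hs2
      · rw [← mul_div_assoc, div_le_div_iff₀ h hx]; linarith
    refine ⟨d₂ * y₂ ^ 2 / x₂ + d₁ * y₁ ^ 2 / (1 - x₂), x₁ + x₂ - 1, 0, y₂ / x₂,
      y₁ / (1 - x₂), y₂ / x₂, ?_, ?_⟩
    · rw [quot₀_eq_coe (fun h => by simp [h₂ h]), quot₀_eq_coe (fun h => by simp [h0 h]),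
        EReal.coe_add]
    · refine ⟨by linarith, fun m _ hm => hm, le_rfl, by linarith, by linarith, by simp,
        mul_nonneg (by linarith) hs2, ?_, ?_, by linarith, by linarith, ?_, ?_, ?_⟩
      · linear_combination -e1
      · linear_combination -e2
      · have : 0 ≤ d₁ * (y₁ / (1 - x₂)) ^ 2 := by positivity
        linarith
      · rw [v1, v2]
        linear_combination 2 * d₁ * (y₁ / (1 - x₂)) * e1 + 2 * d₂ * (y₂ / x₂) * e2
      · rw [v1, v2]; ring
  · obtain ⟨hy, -, hc⟩ := c3
    have hx : 0 < x₁ := by linarith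
    have hc' : d₂ * x₁ * y₂ ≤ (1 - x₁) * y₁ := by
      rw [le_div_iff₀ hy] at hc; linarith
    have h0 : 1 - x₁ = 0 → y₂ = 0 := by
      intro h
      rw [h, zero_mul] at hc'
      have : 0 < d₂ * x₁ := by positivity
      nlinarith
    have e1 : y₁ / x₁ * x₁ = y₁ := div_mul_cancel_of_imp h₁
    have e2 : y₂ / (1 - x₁) * (1 - x₁) = y₂ := div_mul_cancel_of_imp h0
    have v1 : d₁ * y₁ ^ 2 / x₁ = d₁ * (y₁ / x₁) ^ 2 * x₁ := by
      conv_rhs => rw [pow_two, mul_assoc, mul_assoc, e1]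
      ring
    have v2 : d₂ * y₂ ^ 2 / (1 - x₁) = d₂ * (y₂ / (1 - x₁)) ^ 2 * (1 - x₁) := by
      conv_rhs => rw [pow_two, mul_assoc, mul_assoc, e2]
      ring
    have hs1 : 0 ≤ y₁ / x₁ := div_nonneg hy₁ (by linarith)
    have hs2 : 0 ≤ y₂ / (1 - x₁) := div_nonneg hy₂ (by linarith)
    have hg : d₂ * (y₂ / (1 - x₁)) ≤ y₁ / x₁ := by
      rcases (sub_nonneg.2 hx₁1).eq_or_lt with h | h
      · rw [← h, div_zero, mul_zero]; exact hs1
      · rw [← mul_div_assoc, div_le_div_iff₀ h hx]; linarith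
    refine ⟨d₁ * y₁ ^ 2 / x₁ + d₂ * y₂ ^ 2 / (1 - x₁), x₁ + x₂ - 1, y₁ / x₁, 0,
      y₁ / x₁, y₂ / (1 - x₁), ?_, ?_⟩
    · rw [quot₀_eq_coe (fun h => by simp [h₁ h]), quot₀_eq_coe (fun h => by simp [h0 h]),
        EReal.coe_add]
    · refine ⟨by linarith, fun m _ hm => hm, le_rfl, by linarith, by linarith,
        mul_nonneg (by linarith) hs1, by simp, ?_, ?_, by linarith, by linarith, ?_, ?_, ?_⟩
      · linear_combination -e1
      · linear_combination -e2
      · have : 0 ≤ d₂ * (y₂ / (1 - x₁)) ^ 2 := by positivity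
        linarith
      · rw [v1, v2]
        linear_combination 2 * d₁ * (y₁ / x₁) * e1 + 2 * d₂ * (y₂ / (1 - x₁)) * e2
      · rw [v1, v2]; ring
  · push Not at c1
    have hl : 0 < x₁ + x₂ - 1 := by linarith
    have hden : 0 < d₁ * d₂ * x₁ * x₂ - (1 - x₁) * (1 - x₂) := by
      nlinarith [mul_nonneg (mul_nonneg (sub_nonneg.2 hd) hx₁0) hx₂0]
    have k1 : (1 - x₂) * y₂ ≤ d₁ * x₂ * y₁ := by
      rcases hy₂.eq_or_lt with h | h
      · rw [← h, mul_zero]; positivity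
      · by_contra h'
        exact c2 ⟨h, hl.le, by rw [le_div_iff₀ h]; linarith⟩
    have k2 : (1 - x₁) * y₁ ≤ d₂ * x₁ * y₂ := by
      rcases hy₁.eq_or_lt with h | h
      · rw [← h, mul_zero]; positivity
      · by_contra h'
        exact c3 ⟨h, hl.le, by rw [le_div_iff₀ h]; linarith⟩
    -- Both gradient conditions are taken tight; eliminating `s` from the two splits leaves a linear
    -- system for `p`. Failure of the previous two conditions makes its solution nonnegative.
    obtain ⟨p₁, hp₁⟩ : ∃ p, p = d₂ * (d₁ * x₂ * y₁ - (1 - x₂) * y₂) /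
      (d₁ * d₂ * x₁ * x₂ - (1 - x₁) * (1 - x₂)) := ⟨_, rfl⟩
    obtain ⟨p₂, hp₂⟩ : ∃ p, p = d₁ * (d₂ * x₁ * y₂ - (1 - x₁) * y₁) /
      (d₁ * d₂ * x₁ * x₂ - (1 - x₁) * (1 - x₂)) := ⟨_, rfl⟩
    have p1 : 0 ≤ p₁ := by
      rw [hp₁]; exact div_nonneg (mul_nonneg hd₂.le (sub_nonneg.2 k1)) hden.le
    have p2 : 0 ≤ p₂ := by
      rw [hp₂]; exact div_nonneg (mul_nonneg hd₁.le (sub_nonneg.2 k2)) hden.le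
    obtain ⟨s₁, hs₁⟩ : ∃ s, s = p₁ + p₂ / d₁ := ⟨_, rfl⟩
    obtain ⟨s₂, hs₂⟩ : ∃ s, s = p₂ + p₁ / d₂ := ⟨_, rfl⟩
    have t1 : d₁ * s₁ = d₁ * p₁ + p₂ := by rw [hs₁]; field_simp
    have t2 : d₂ * s₂ = p₁ + d₂ * p₂ := by rw [hs₂]; field_simp; ring
    have q1 := (eq_div_iff hden.ne').1 hp₁
    have q2 := (eq_div_iff hden.ne').1 hp₂
    have sp1 : y₁ = (x₁ + x₂ - 1) * p₁ + s₁ * (x₁ - (x₁ + x₂ - 1)) := by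
      apply mul_left_cancel₀ (mul_pos hd₁ hden).ne'
      linear_combination -(1 - x₂) * (d₁ * d₂ * x₁ * x₂ - (1 - x₁) * (1 - x₂)) * t1
        - d₁ * x₁ * q1 - (1 - x₂) * q2
    have sp2 : y₂ = (x₁ + x₂ - 1) * p₂ + s₂ * (x₂ - (x₁ + x₂ - 1)) := by
      apply mul_left_cancel₀ (mul_pos hd₂ hden).ne'
      linear_combination -(1 - x₁) * (d₁ * d₂ * x₁ * x₂ - (1 - x₁) * (1 - x₂)) * t2
        - d₂ * x₂ * q2 - (1 - x₁) * q1
    have hv : fPiece x₁ x₂ y₁ y₂ (x₁ + x₂ - 1) d₁ d₂ = d₁ * s₁ * y₁ + d₂ * s₂ * y₂ := by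
      have hden' : (d₁ * d₂ - 1) * x₁ * x₂ - (x₁ + x₂ - 1) ^ 2 + (x₁ + x₂ - 1) * (x₁ + x₂)
        = d₁ * d₂ * x₁ * x₂ - (1 - x₁) * (1 - x₂) := by ring
      have := hden.ne'
      rw [t1, t2, fPiece, hden', hp₁, hp₂]; field_simp; ring
    refine ⟨_, x₁ + x₂ - 1, p₁, p₂, s₁, s₂, rfl, by linarith, fun m _ hm => hm, le_rfl,
      by linarith, by linarith, mul_nonneg hl.le p1, mul_nonneg hl.le p2, sp1, sp2, t1.le, t2.le,
      ?_, ?_, ?_⟩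
    · have a1 : d₁ * s₁ ^ 2 = d₁ * p₁ ^ 2 + p₁ * p₂ + p₂ * s₁ := by
        linear_combination s₁ * t1 + p₁ * t1
      have a2 : d₂ * s₂ ^ 2 = d₂ * p₂ ^ 2 + p₁ * p₂ + p₁ * s₂ := by
        linear_combination s₂ * t2 + p₂ * t2
      have : 0 ≤ s₁ := by rw [hs₁]; positivity
      have : 0 ≤ s₂ := by rw [hs₂]; positivity
      have := mul_nonneg p2 ‹0 ≤ s₁›
      have := mul_nonneg p1 ‹0 ≤ s₂›
      linarith
    · rw [hv]
      linear_combination (-d₁ * s₁) * sp1 + (-d₂ * s₂) * sp2 -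
        (x₁ + x₂ - 1) * p₁ * t1 - (x₁ + x₂ - 1) * p₂ * t2
    · rw [hv]
      linear_combination (d₁ * s₁) * sp1 + (d₂ * s₂) * sp2 +
        (x₁ + x₂ - 1) * p₁ * t1 + (x₁ + x₂ - 1) * p₂ * t2

/-! ### Weak duality and attainment -/

theorem Matrix.PosSemidef.quadraticForm_three {W : Matrix (Fin 3) (Fin 3) ℝ} (hW : W.PosSemidef) :
    W 1 0 = W 0 1 ∧ W 0 2 = W 2 0 ∧ W 1 2 = W 2 1 ∧ ∀ a b c : ℝ,
      0 ≤ a ^ 2 * W 0 0 + b ^ 2 * W 1 1 + c ^ 2 * W 2 2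
        + 2 * a * b * W 0 1 + 2 * a * c * W 2 0 + 2 * b * c * W 2 1 := by
  have h1 : W 1 0 = W 0 1 := by simpa using (hW.1.apply 0 1)
  have h2 : W 0 2 = W 2 0 := by simpa using (hW.1.apply 2 0)
  have h3 : W 1 2 = W 2 1 := by simpa using (hW.1.apply 2 1)
  refine ⟨h1, h2, h3, fun a b c => ?_⟩
  have h := hW.dotProduct_mulVec_nonneg ![a, b, c]
  simp [dotProduct, Matrix.mulVec, Fin.sum_univ_three, h1, h2, h3] at h
  linarith

/-- For `b > 0` this is the tangent line of `c ^ 2 / b` at slope `s`; it linearises the cone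
constraints in weak duality. -/
theorem rotated_cone_tangent {a b c : ℝ} (ha : 0 ≤ a) (hb : 0 ≤ b) (h : c ^ 2 ≤ a * b) (s : ℝ) :
    2 * s * c - s ^ 2 * b ≤ a := by
  rcases hb.eq_or_lt with h0 | h0
  · rw [← h0, mul_zero] at h
    have : c = 0 := by nlinarith
    rw [this, ← h0]; linarith
  · nlinarith [sq_nonneg (c - s * b)]

/-- Weak duality: a certified value is a lower bound on every feasible lift. -/
theorem Certificate.le_of_feasibleLift {x₁ x₂ y₁ y₂ d₁ d₂ v l p₁ p₂ s₁ s₂ Y₁₁ Y₁₂ Y₂₂ : ℝ}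
    {W : Matrix (Fin 3) (Fin 3) ℝ} (hd₁ : 0 < d₁) (hd₂ : 0 < d₂) (hd : 1 ≤ d₁ * d₂)
    (hc : Certificate x₁ x₂ y₁ y₂ d₁ d₂ v l p₁ p₂ s₁ s₂)
    (hW : FeasibleLift x₁ x₂ y₁ y₂ Y₁₁ Y₁₂ Y₂₂ W) :
    v ≤ d₁ * Y₁₁ + d₂ * Y₂₂ + 2 * Y₁₂ := by
  obtain ⟨hpsd, h01, ⟨hc1, ha1, hb1⟩, ⟨hc2, ha2, hb2⟩, ⟨hz1, hz2⟩, hl⟩ := hW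
  obtain ⟨-, -, -, Q⟩ := hpsd.quadraticForm_three
  have hl0 : 0 ≤ W 2 2 := by simpa using Q 0 0 1
  have hle := hc.le_of _ hl0 hl
  have T1 := mul_le_mul_of_nonneg_left
    (rotated_cone_tangent (sub_nonneg.2 ha1) (sub_nonneg.2 hb1) hc1 s₁) hd₁.le
  have T2 := mul_le_mul_of_nonneg_left
    (rotated_cone_tangent (sub_nonneg.2 ha2) (sub_nonneg.2 hb2) hc2 s₂) hd₂.le
  have G1 := mul_le_mul_of_nonneg_right hc.grad₁ hz1
  have G2 := mul_le_mul_of_nonneg_right hc.grad₂ hz2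
  have L := mul_le_mul_of_nonneg_right hle (sub_nonneg.2 hc.weight)
  -- Completing the square: `d₁ * (d₁ a² + 2ab + d₂ b²) = (d₁ a + b)² + (d₁ d₂ - 1) b²`, with the
  -- variables shifted by `p`.
  have Q1 := Q d₁ 1 (-(d₁ * p₁ + p₂))
  have Q2 := mul_nonneg (sub_nonneg.2 hd) (Q 0 1 (-p₂))
  have M : 0 ≤ d₁ * W 0 0 + d₂ * W 1 1 + 2 * W 0 1
      - 2 * ((d₁ * p₁ + p₂) * W 2 0 + (p₁ + d₂ * p₂) * W 2 1)
      + (d₁ * p₁ ^ 2 + 2 * p₁ * p₂ + d₂ * p₂ ^ 2) * W 2 2 := by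
    refine nonneg_of_mul_nonneg_right ?_ hd₁
    linarith
  rw [hc.dual]
  linarith

/-- The lift attaining a certified value. -/
theorem Certificate.exists_feasibleLift {x₁ x₂ y₁ y₂ d₁ d₂ v l p₁ p₂ s₁ s₂ : ℝ}
    (hc : Certificate x₁ x₂ y₁ y₂ d₁ d₂ v l p₁ p₂ s₁ s₂) :
    ∃ W, FeasibleLift x₁ x₂ y₁ y₂ (l * p₁ ^ 2 + s₁ ^ 2 * (x₁ - l)) (l * p₁ * p₂)
      (l * p₂ ^ 2 + s₂ ^ 2 * (x₂ - l)) W := by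
  refine ⟨l • Matrix.vecMulVec ![p₁, p₂, 1] (star ![p₁, p₂, 1]),
    (Matrix.posSemidef_vecMulVec_self_star _).smul hc.nonneg, ?_⟩
  have b1 := sub_nonneg.2 hc.le₁
  have b2 := sub_nonneg.2 hc.le₂
  have c1 := mul_nonneg (sq_nonneg s₁) b1
  have c2 := mul_nonneg (sq_nonneg s₂) b2
  have e1 := hc.split₁
  have e2 := hc.split₂
  simp only [Matrix.smul_apply, Matrix.vecMulVec_apply, smul_eq_mul, star_trivial,
    Matrix.cons_val]
  refine ⟨by linarith, ⟨?_, by linarith, by linarith [hc.le₁]⟩,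
    ⟨?_, by linarith, by linarith [hc.le₂]⟩, ⟨by linarith [hc.slope₁], by linarith [hc.slope₂]⟩,
    by linarith [hc.ge]⟩
  · apply le_of_eq; rw [e1]; ring
  · apply le_of_eq; rw [e2]; ring

/-- A vanishing `xᵢ` squeezes `W 2 2` to zero; semidefiniteness then kills the matching off-diagonal
entry, and the cone constraint kills `yᵢ`. -/
theorem FeasibleLift.eq_zero_of_eq_zero {x₁ x₂ y₁ y₂ Y₁₁ Y₁₂ Y₂₂ : ℝ}
    {W : Matrix (Fin 3) (Fin 3) ℝ} (hW : FeasibleLift x₁ x₂ y₁ y₂ Y₁₁ Y₁₂ Y₂₂ W) :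
    (x₁ = 0 → y₁ = 0) ∧ (x₂ = 0 → y₂ = 0) := by
  obtain ⟨hpsd, h01, ⟨hc1, ha1, hb1⟩, ⟨hc2, ha2, hb2⟩, ⟨hz1, hz2⟩, hl⟩ := hW
  obtain ⟨-, -, -, Q⟩ := hpsd.quadraticForm_three
  have hl0 : 0 ≤ W 2 2 := by simpa using Q 0 0 1
  constructor
  · intro h
    have h22 : W 2 2 = 0 := by linarith
    have := discrim_le_zero (a := W 2 2) (b := 2 * W 2 0) (c := W 0 0)
      (fun t => by linarith [Q 1 0 t])
    have hz : W 2 0 = 0 := by rw [discrim, h22] at this; nlinarith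
    rw [hz, h22, h] at hc1
    nlinarith
  · intro h
    have h22 : W 2 2 = 0 := by linarith
    have := discrim_le_zero (a := W 2 2) (b := 2 * W 2 1) (c := W 1 1)
      (fun t => by linarith [Q 0 1 t])
    have hz : W 2 1 = 0 := by rw [discrim, h22] at this; nlinarith
    rw [hz, h22, h] at hc2
    nlinarith

/-! ### Convexity and closedness of the liftable set -/

/-- The triples `(Y₁₁, Y₁₂, Y₂₂)` that admit a feasible lift. -/
def liftableSet (x₁ x₂ y₁ y₂ : ℝ) : Set (ℝ × ℝ × ℝ) :=
  {Y | ∃ W, FeasibleLift x₁ x₂ y₁ y₂ Y.1 Y.2.1 Y.2.2 W}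

/-- The cross term obeys `2cc' ≤ ab' + a'b` by AM-GM. -/
theorem rotated_cone_convex {a b c a' b' c' s t : ℝ} (ha : 0 ≤ a) (hb : 0 ≤ b) (h : c ^ 2 ≤ a * b)
    (ha' : 0 ≤ a') (hb' : 0 ≤ b') (h' : c' ^ 2 ≤ a' * b') (hs : 0 ≤ s) (ht : 0 ≤ t) :
    (s * c + t * c') ^ 2 ≤ (s * a + t * a') * (s * b + t * b') := by
  have hcc : (2 * (c * c')) ≤ a * b' + a' * b := by
    apply le_of_sq_le_sq _ (by positivity)
    have := mul_le_mul h h' (sq_nonneg _) (by positivity)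
    nlinarith [sq_nonneg (a * b' - a' * b)]
  have h1 := mul_le_mul_of_nonneg_left h (sq_nonneg s)
  have h2 := mul_le_mul_of_nonneg_left h' (sq_nonneg t)
  have h3 := mul_le_mul_of_nonneg_left hcc (mul_nonneg hs ht)
  linarith

theorem convex_liftableSet (x₁ x₂ y₁ y₂ : ℝ) : Convex ℝ (liftableSet x₁ x₂ y₁ y₂) := by
  rintro ⟨a, b, c⟩ ⟨W, hW⟩ ⟨a', b', c'⟩ ⟨W', hW'⟩ s t hs ht hst
  refine ⟨s • W + t • W', (hW.1.smul hs).add (hW'.1.smul ht), ?_⟩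
  obtain ⟨-, h01, ⟨hc1, ha1, hb1⟩, ⟨hc2, ha2, hb2⟩, ⟨hz1, hz2⟩, hl⟩ := hW
  obtain ⟨-, h01', ⟨hc1', ha1', hb1'⟩, ⟨hc2', ha2', hb2'⟩, ⟨hz1', hz2'⟩, hl'⟩ := hW'
  obtain rfl : t = 1 - s := by linarith
  simp only [Matrix.add_apply, Matrix.smul_apply, smul_eq_mul, Prod.smul_mk, Prod.mk_add_mk]
  have key (u v : ℝ) (h : u ≤ v) (u' v' : ℝ) (h' : u' ≤ v') :
      s * u + (1 - s) * u' ≤ s * v + (1 - s) * v' :=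
    add_le_add (mul_le_mul_of_nonneg_left h hs) (mul_le_mul_of_nonneg_left h' ht)
  refine ⟨key _ _ h01 _ _ h01', ⟨?_, key _ _ ha1 _ _ ha1', ?_⟩, ⟨?_, key _ _ ha2 _ _ ha2', ?_⟩,
    ⟨?_, ?_⟩, ?_⟩
  · have := rotated_cone_convex (sub_nonneg.2 ha1) (sub_nonneg.2 hb1) hc1
      (sub_nonneg.2 ha1') (sub_nonneg.2 hb1') hc1' hs ht
    convert this using 1 <;> ring
  · linarith [key _ _ hb1 _ _ hb1']
  · have := rotated_cone_convex (sub_nonneg.2 ha2) (sub_nonneg.2 hb2) hc2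
      (sub_nonneg.2 ha2') (sub_nonneg.2 hb2') hc2' hs ht
    convert this using 1 <;> ring
  · linarith [key _ _ hb2 _ _ hb2']
  · positivity
  · positivity
  · linarith [key _ _ hl _ _ hl']

theorem Matrix.PosSemidef.abs_apply_le_trace {W : Matrix (Fin 3) (Fin 3) ℝ} (hW : W.PosSemidef)
    (i j : Fin 3) : |W i j| ≤ W 0 0 + W 1 1 + W 2 2 := by
  obtain ⟨h1, h2, h3, Q⟩ := hW.quadraticForm_three
  have q0 := Q 1 0 0
  have q1 := Q 0 1 0
  have q2 := Q 0 0 1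
  have := Q 1 1 0
  have := Q 1 (-1) 0
  have := Q 1 0 1
  have := Q 1 0 (-1)
  have := Q 0 1 1
  have := Q 0 1 (-1)
  rw [abs_le]
  fin_cases i <;> fin_cases j <;> simp only [Fin.zero_eta, Fin.mk_one, Fin.reduceFinMk, h1, h2,
    h3] <;> constructor <;> linarith

-- Along a convergent sequence of triples, `W 0 0 ≤ Y₁₁`, `W 1 1 ≤ Y₂₂` and `W 2 2 ≤ x₁` bound the
-- trace, hence every entry of `W`; a subsequence of lifts converges.
open Filter Topology in
theorem isClosed_liftableSet (x₁ x₂ y₁ y₂ : ℝ) : IsClosed (liftableSet x₁ x₂ y₁ y₂) := by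
  have : FirstCountableTopology (Matrix (Fin 3) (Fin 3) ℝ) :=
    inferInstanceAs (FirstCountableTopology (Fin 3 → Fin 3 → ℝ))
  apply IsSeqClosed.isClosed
  intro Y Y' hY hlim
  choose W hW using hY
  have l1 : Tendsto (fun n => (Y n).1) atTop (𝓝 Y'.1) := (continuous_fst.tendsto _).comp hlim
  have l2 : Tendsto (fun n => (Y n).2.1) atTop (𝓝 Y'.2.1) :=
    ((continuous_fst.comp continuous_snd).tendsto _).comp hlim
  have l3 : Tendsto (fun n => (Y n).2.2) atTop (𝓝 Y'.2.2) :=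
    ((continuous_snd.comp continuous_snd).tendsto _).comp hlim
  obtain ⟨R, hR⟩ := ((l1.add l3).add_const x₁).bddAbove_range
  have hcpt : IsCompact {V : Matrix (Fin 3) (Fin 3) ℝ | ∀ i j, V i j ∈ Set.Icc (-R) R} := by
    have := isCompact_univ_pi (fun _ : Fin 3 =>
      isCompact_univ_pi (fun _ : Fin 3 => isCompact_Icc (a := -R) (b := R)))
    have hset : {V : Matrix (Fin 3) (Fin 3) ℝ | ∀ i j, V i j ∈ Set.Icc (-R) R} =
        Set.univ.pi fun _ : Fin 3 => Set.univ.pi fun _ : Fin 3 => Set.Icc (-R) R :=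
      Set.ext fun V =>
        ⟨fun h i _ j _ => h i j, fun h i j => h i trivial j trivial⟩
    rw [hset]
    exact this
  obtain ⟨V, -, φ, hφ, hV⟩ := hcpt.tendsto_subseq (x := W) (fun n i j => by
    rw [Set.mem_Icc, ← abs_le]
    obtain ⟨hpsd, -, ⟨-, ha1, hb1⟩, ⟨-, ha2, -⟩, -⟩ := hW n
    have := hR ⟨n, rfl⟩
    simp only at this
    linarith [hpsd.abs_apply_le_trace i j])
  have hVij (i j) : Tendsto (fun n => W (φ n) i j) atTop (𝓝 (V i j)) :=
    ((continuous_apply_apply i j).tendsto V).comp hV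
  have l1' := l1.comp hφ.tendsto_atTop
  have l2' := l2.comp hφ.tendsto_atTop
  have l3' := l3.comp hφ.tendsto_atTop
  refine ⟨V, ?_, ?_, ⟨?_, ?_, ?_⟩, ⟨?_, ?_, ?_⟩, ⟨?_, ?_⟩, ?_⟩
  · refine Matrix.PosSemidef.of_dotProduct_mulVec_nonneg ?_ fun z => ?_
    · ext i j
      refine tendsto_nhds_unique (hVij j i) ((hVij i j).congr fun n => ?_)
      simpa using (hW (φ n)).1.1.apply j i
    · have hcont : Continuous fun U : Matrix (Fin 3) (Fin 3) ℝ => star z ⬝ᵥ U.mulVec z := by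
        fun_prop
      exact ge_of_tendsto' ((hcont.tendsto V).comp hV)
        fun n => (hW (φ n)).1.dotProduct_mulVec_nonneg z
  · exact le_of_tendsto_of_tendsto' (hVij 0 1) l2' fun n => (hW (φ n)).2.1
  · exact le_of_tendsto_of_tendsto' (((hVij 2 0).const_sub y₁).pow 2)
      ((l1'.sub (hVij 0 0)).mul ((hVij 2 2).const_sub x₁)) fun n => (hW (φ n)).2.2.1.1
  · exact le_of_tendsto_of_tendsto' (hVij 0 0) l1' fun n => (hW (φ n)).2.2.1.2.1
  · exact le_of_tendsto' (hVij 2 2) fun n => (hW (φ n)).2.2.1.2.2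
  · exact le_of_tendsto_of_tendsto' (((hVij 2 1).const_sub y₂).pow 2)
      ((l3'.sub (hVij 1 1)).mul ((hVij 2 2).const_sub x₂)) fun n => (hW (φ n)).2.2.2.1.1
  · exact le_of_tendsto_of_tendsto' (hVij 1 1) l3' fun n => (hW (φ n)).2.2.2.1.2.1
  · exact le_of_tendsto' (hVij 2 2) fun n => (hW (φ n)).2.2.2.1.2.2
  · exact ge_of_tendsto' (hVij 2 0) fun n => (hW (φ n)).2.2.2.2.1.1
  · exact ge_of_tendsto' (hVij 2 1) fun n => (hW (φ n)).2.2.2.2.1.2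
  · exact ge_of_tendsto' (hVij 2 2) fun n => (hW (φ n)).2.2.2.2.2

/-! ### Recession directions and separation -/

/-- Adding `(a, b, 0)(a, b, 0)ᵀ` to `W` preserves its last row and the gaps `Yᵢᵢ - Wᵢᵢ`; `t` only
loosens the bound on `W 0 1`. -/
theorem liftableSet_add_mem {x₁ x₂ y₁ y₂ : ℝ} {Y : ℝ × ℝ × ℝ} (hY : Y ∈ liftableSet x₁ x₂ y₁ y₂)
    (a b : ℝ) {t : ℝ} (ht : 0 ≤ t) :
    (Y.1 + a ^ 2, Y.2.1 + a * b + t, Y.2.2 + b ^ 2) ∈ liftableSet x₁ x₂ y₁ y₂ := by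
  obtain ⟨W, hpsd, h⟩ := hY
  refine ⟨W + Matrix.vecMulVec ![a, b, 0] (star ![a, b, 0]),
    hpsd.add (Matrix.posSemidef_vecMulVec_self_star _), ?_⟩
  simp only [Matrix.add_apply, Matrix.vecMulVec_apply, star_trivial,
    Matrix.cons_val, mul_zero, zero_mul, add_zero]
  obtain ⟨h01, ⟨hc1, ha1, hb1⟩, ⟨hc2, ha2, hb2⟩, hz, hl⟩ := h
  refine ⟨by linarith, ⟨?_, by linarith, hb1⟩, ⟨?_, by linarith, hb2⟩, hz, hl⟩
  · convert hc1 using 2; ring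
  · convert hc2 using 2; ring

/-- A linear functional bounded below on the liftable set is nonnegative on its recession cone. -/
theorem dual_cone_of_bddBelow {x₁ x₂ y₁ y₂ e₁ e e₂ u : ℝ} {Y : ℝ × ℝ × ℝ}
    (hY : Y ∈ liftableSet x₁ x₂ y₁ y₂)
    (h : ∀ Z ∈ liftableSet x₁ x₂ y₁ y₂, u < e₁ * Z.1 + 2 * e * Z.2.1 + e₂ * Z.2.2) :
    0 ≤ e₁ ∧ 0 ≤ e₂ ∧ 0 ≤ e ∧ e ^ 2 ≤ e₁ * e₂ := by
  obtain ⟨k, hk⟩ : ∃ k, k = e₁ * Y.1 + 2 * e * Y.2.1 + e₂ * Y.2.2 - u := ⟨_, rfl⟩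
  have hk0 : 0 < k := by have := h Y hY; linarith
  have ray (q : ℝ) (hq : ∀ r : ℝ, 0 ≤ r → 0 < k + r * q) : 0 ≤ q := by
    by_contra hn
    push Not at hn
    have := hq (k / (-q)) (div_nonneg hk0.le (by linarith))
    have h2 : k / (-q) * q = -k := by rw [div_neg, neg_mul, div_mul_cancel₀ _ hn.ne]
    linarith
  have quad (a b : ℝ) : 0 ≤ e₁ * a ^ 2 + 2 * e * (a * b) + e₂ * b ^ 2 := by
    refine ray _ fun r hr => ?_
    have := h _ (liftableSet_add_mem hY (√r * a) (√r * b) le_rfl)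
    have hs := Real.mul_self_sqrt hr
    rw [← hs]
    linarith
  have he1 : 0 ≤ e₁ := by simpa using quad 1 0
  have he2 : 0 ≤ e₂ := by simpa using quad 0 1
  refine ⟨he1, he2, ?_, ?_⟩
  · have : 0 ≤ 2 * e := ray _ fun r hr => by
      have := h _ (liftableSet_add_mem hY 0 0 hr)
      simp only at this
      linarith
    linarith
  · have := discrim_le_zero (a := e₁) (b := 2 * e) (c := e₂) fun t => by
      linarith [quad t 1]
    rw [discrim] at this
    linarith

theorem mem_liftableSet_of_forall_le {x₁ x₂ y₁ y₂ Y₁₁ Y₁₂ Y₂₂ : ℝ}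
    (h : ∀ d ∈ coeffSet, ∃ v l p₁ p₂ s₁ s₂ : ℝ,
      Certificate x₁ x₂ y₁ y₂ d.1 d.2 v l p₁ p₂ s₁ s₂ ∧ v ≤ d.1 * Y₁₁ + d.2 * Y₂₂ + 2 * Y₁₂) :
    (Y₁₁, Y₁₂, Y₂₂) ∈ liftableSet x₁ x₂ y₁ y₂ := by
  by_contra hY
  obtain ⟨f, u, hfY, hf⟩ := geometric_hahn_banach_point_closed (convex_liftableSet x₁ x₂ y₁ y₂)
    (isClosed_liftableSet x₁ x₂ y₁ y₂) hY
  obtain ⟨e₁, he₁⟩ : ∃ r, r = f (1, 0, 0) := ⟨_, rfl⟩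
  obtain ⟨e, he⟩ : ∃ r, r = f (0, 1, 0) / 2 := ⟨_, rfl⟩
  obtain ⟨e₂, he₂⟩ : ∃ r, r = f (0, 0, 1) := ⟨_, rfl⟩
  have hfun (a b c : ℝ) : f (a, b, c) = e₁ * a + 2 * e * b + e₂ * c := by
    have : ((a, b, c) : ℝ × ℝ × ℝ) = a • (1, 0, 0) + b • (0, 1, 0) + c • (0, 0, 1) := by
      simp
    rw [this, map_add, map_add, map_smul, map_smul, map_smul, he₁, he, he₂]
    simp only [smul_eq_mul]; ring
  have hf' : ∀ Z ∈ liftableSet x₁ x₂ y₁ y₂, u < e₁ * Z.1 + 2 * e * Z.2.1 + e₂ * Z.2.2 :=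
    fun Z hZ => by rw [← hfun]; exact hf Z hZ
  rw [hfun] at hfY
  obtain ⟨v, l, p₁, p₂, s₁, s₂, hc, -⟩ := h (1, 1) (by simp [coeffSet])
  obtain ⟨W, hW⟩ := hc.exists_feasibleLift
  obtain ⟨h1, h2, h0, hd⟩ := dual_cone_of_bddBelow (Y := (_, _, _)) ⟨W, hW⟩ hf'
  -- Since `e` may be zero, a small multiple of the functional for `d = (1, 1)` is added, keeping
  -- the triple strictly below `u`.
  obtain ⟨ε, hε0, hε⟩ : ∃ ε : ℝ, 0 < ε ∧
      e₁ * Y₁₁ + 2 * e * Y₁₂ + e₂ * Y₂₂ + ε * (Y₁₁ + 2 * Y₁₂ + Y₂₂) < u := by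
    obtain ⟨T, hT⟩ : ∃ T, T = Y₁₁ + 2 * Y₁₂ + Y₂₂ := ⟨_, rfl⟩
    rw [← hT]
    obtain ⟨g, hg⟩ : ∃ g, g = u - (e₁ * Y₁₁ + 2 * e * Y₁₂ + e₂ * Y₂₂) := ⟨_, rfl⟩
    have hg0 : 0 < g := by linarith
    have hT1 : 0 < |T| + 1 := by positivity
    refine ⟨g / (|T| + 1), by positivity, ?_⟩
    have : g / (|T| + 1) * T < g := by
      rw [div_mul_eq_mul_div, div_lt_iff₀ hT1]
      exact mul_lt_mul_of_pos_left (by linarith [le_abs_self T]) hg0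
    linarith
  have hpos : 0 < e + ε := by linarith
  obtain ⟨v, l, p₁, p₂, s₁, s₂, hc, hv⟩ := h ((e₁ + ε) / (e + ε), (e₂ + ε) / (e + ε)) (by
    refine ⟨by positivity, by positivity, ?_⟩
    simp only
    rw [div_mul_div_comm, one_le_div (by positivity)]
    have : 2 * e ≤ e₁ + e₂ := by
      apply le_of_sq_le_sq _ (by positivity)
      nlinarith [sq_nonneg (e₁ - e₂)]
    nlinarith)
  obtain ⟨W, hW⟩ := hc.exists_feasibleLift
  have hu := hf' (_, _, _) ⟨W, hW⟩
  have hp := hc.primal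
  simp only at hu hp hv
  -- The added functional is nonnegative at the attaining lift, so the perturbed functional stays
  -- above `u` there.
  have n1 := mul_nonneg hc.nonneg (sq_nonneg (p₁ + p₂))
  have n2 := mul_nonneg (sq_nonneg s₁) (sub_nonneg.2 hc.le₁)
  have n3 := mul_nonneg (sq_nonneg s₂) (sub_nonneg.2 hc.le₂)
  have n := mul_nonneg hε0.le (add_nonneg (add_nonneg n1 n2) n3)
  rw [hp] at hv
  have hv' := mul_le_mul_of_nonneg_left hv hpos.le
  have m1 : (e + ε) * ((e₁ + ε) / (e + ε)) = e₁ + ε := by field_simp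
  have m2 : (e + ε) * ((e₂ + ε) / (e + ε)) = e₂ + ε := by field_simp
  simp only [mul_add, ← mul_assoc, m1, m2] at hv'
  linarith

/-! ### Infinite values and the equivalence -/

theorem quot₀_ne_bot (a b : ℝ) : quot₀ a b ≠ ⊥ := by
  unfold quot₀
  split_ifs <;> simp

/-- If the envelope is not `⊤`, vanishing indicators force vanishing variables. -/
theorem eq_zero_of_fPlusStar_ne_top {x₁ x₂ y₁ y₂ d₁ d₂ : ℝ} (hx₁ : x₁ ≤ 1) (hx₂ : x₂ ≤ 1)
    (hd₁ : 0 < d₁) (hd₂ : 0 < d₂) (h : fPlusStar x₁ x₂ y₁ y₂ d₁ d₂ ≠ ⊤) :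
    (x₁ = 0 → y₁ = 0) ∧ (x₂ = 0 → y₂ = 0) := by
  constructor
  · rintro rfl
    by_contra hy
    apply h
    rw [fPlusStar, if_pos (by linarith)]
    have : quot₀ (d₁ * y₁ ^ 2) 0 = ⊤ := by simp [quot₀, hy, hd₁.ne']
    rw [this, EReal.top_add_of_ne_bot (quot₀_ne_bot _ _)]
  · rintro rfl
    by_contra hy
    apply h
    rw [fPlusStar, if_pos (by linarith)]
    have : quot₀ (d₂ * y₂ ^ 2) 0 = ⊤ := by simp [quot₀, hy, hd₂.ne']
    rw [this, EReal.add_top_of_ne_bot (quot₀_ne_bot _ _)]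

theorem mainTheorem5 (x₁ x₂ y₁ y₂ Y₁₁ Y₁₂ Y₂₂ : ℝ)
    (hx₁ : 0 ≤ x₁ ∧ x₁ ≤ 1) (hx₂ : 0 ≤ x₂ ∧ x₂ ≤ 1) (hy₁ : 0 ≤ y₁) (hy₂ : 0 ≤ y₂) :
    (⨆ d ∈ coeffSet,
        (fPlusStar x₁ x₂ y₁ y₂ d.1 d.2 - ((d.1 * Y₁₁ : ℝ) : EReal) - ((d.2 * Y₂₂ : ℝ) : EReal)
          - ((2 * Y₁₂ : ℝ) : EReal))) ≤ 0 ↔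
      ∃ W : Matrix (Fin 3) (Fin 3) ℝ, W.PosSemidef ∧
        W 0 1 ≤ Y₁₂ ∧
        ((y₁ - W 2 0) ^ 2 ≤ (Y₁₁ - W 0 0) * (x₁ - W 2 2) ∧ W 0 0 ≤ Y₁₁ ∧ W 2 2 ≤ x₁) ∧
        ((y₂ - W 2 1) ^ 2 ≤ (Y₂₂ - W 1 1) * (x₂ - W 2 2) ∧ W 1 1 ≤ Y₂₂ ∧ W 2 2 ≤ x₂) ∧
        (0 ≤ W 2 0 ∧ 0 ≤ W 2 1) ∧
        x₁ + x₂ - 1 ≤ W 2 2 := by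
  rw [iSup₂_le_iff]
  constructor
  · intro h
    -- One coefficient vector suffices to exclude infinite values, since the conclusion does not
    -- involve `d`.
    obtain ⟨h₁, h₂⟩ := eq_zero_of_fPlusStar_ne_top (y₁ := y₁) (y₂ := y₂) (d₁ := 1) (d₂ := 1)
      hx₁.2 hx₂.2 one_pos one_pos (fun ht => by
        have := h (1, 1) (by simp [coeffSet])
        simp only [ht, EReal.top_sub_coe] at this
        simp at this)
    refine mem_liftableSet_of_forall_le fun d hd => ?_
    obtain ⟨hd₁, hd₂⟩ := coeffSet_pos hd
    obtain ⟨v, l, p₁, p₂, s₁, s₂, hv, hc⟩ :=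
      exists_certificate hx₁ hx₂ hy₁ hy₂ h₁ h₂ hd₁ hd₂ hd.2.2
    refine ⟨v, l, p₁, p₂, s₁, s₂, hc, ?_⟩
    have := h d hd
    rw [hv] at this
    norm_cast at this
    linarith
  · rintro ⟨W, hW⟩ d hd
    have hW' : FeasibleLift x₁ x₂ y₁ y₂ Y₁₁ Y₁₂ Y₂₂ W := hW
    obtain ⟨h₁, h₂⟩ := hW'.eq_zero_of_eq_zero
    obtain ⟨hd₁, hd₂⟩ := coeffSet_pos hd
    obtain ⟨v, l, p₁, p₂, s₁, s₂, hv, hc⟩ :=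
      exists_certificate hx₁ hx₂ hy₁ hy₂ h₁ h₂ hd₁ hd₂ hd.2.2
    have := hc.le_of_feasibleLift hd₁ hd₂ hd.2.2 hW'
    rw [hv]
    norm_cast
    linarith
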